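/- Let $\mathcal U,\mathcal V,\mathcal X$ be finite alphabets of sizes $d_U,d_V,d_X$, let $B$ be a quantum system of finite dimension $d_B$, and let $$\rho^{UVXB}=\sum_{u,v,x}p(u,v,x)\,|u\rangle\langle u|\otimes|v\rangle\langle v|\otimes|x\rangle\langle x|\otimes\rho^B_{u,v,x}$$ be a cq-state, with $p$ a probability distribution and the $\rho^B_{u,v,x}$ density matrices on $B$. Let $\rho^B$ be its reduced state on $B$, and let $\rho^B_u$, $\rho^B_v$, $\rho^B_{v,x}$ be the conditional states of $B$ given $U=u$, given $V=v$, and given $(V,X)=(v,x)$; that is, density matrices with $p(u)\rho^B_u=\sum_{v,x}p(u,v,x)\rho^B_{u,v,x}$, $p(v)\rho^B_v=\sum_{u,x}p(u,v,x)\rho^B_{u,v,x}$ and $p(v,x)\rho^B_{v,x}=\sum_{u}p(u,v,x)\rho^B_{u,v,x}$ (arbitrary density matrices for letters of probability zero). For a Hermitian operator $H=\sum_i h_iH_i$ with distinct eigenvalues $h_i$ and orthogonal projections $H_i$ onto the corresponding eigenspaces, the pinching map of $H$ is $\mathcal E_H(Y)=\sum_iH_iYH_i$. For $n\in\mathbb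 N$ and sequences $u^n\in\mathcal U^n$, $v^n\in\mathcal V^n$, $x^n\in\mathcal X^n$ put $$\rho^{B^n}_{u^n}=\bigotimes_{i=1}^n\rho^B_{u_i},\qquad \rho^{B^n}_{v^n}=\bigotimes_{i=1}^n\rho^B_{v_i},\qquad \rho^{B^n}_{v^n,x^n}=\bigotimes_{i=1}^n\rho^B_{v_i,x_i}.$$ Let $\mathcal E^{B^n}$ be the pinching map of $(\rho^B)^{\otimes n}$, and let $\mathcal E^{B^n}_{1|u^n}$ be the pinching map of $\mathcal E^{B^n}(\rho^{B^n}_{u^n})$. Let $\nu$ be the number of distinct eigenvalues of $(\rho^B)^{\otimes n}$, and let $\nu_1,\nu_2,\nu_3$ be the maximal numbers of distinct eigenvalues of $\mathcal E^{B^n}(\rho^{B^n}_{u^n})$ over all $u^n$, of $\mathcal E^{B^n}_{1|u^n}(\rho^{B^n}_{v^n})$ over all $u^n,v^n$, and of $\mathcal E^{B^n}_{1|u^n}(\rho^{B^n}_{v^n,x^n})$ over all $u^n,v^n,x^n$, respectively. Then these numbers are polynomially bounded in $n$; more precisely, for every $n$, $$\nu\le(n+1)^{d_B-1},\qquad \nu_1\le(n+1)^{d_U(d_B+2)(d_B-1)/2},$$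 $$\nu_2\le(n+1)^{d_Vd_U(d_B+2)(d_B-1)/2},\qquad \nu_3\le(n+1)^{d_Xd_Vd_U(d_B+2)(d_B-1)/2}.$$ -/

import Mathlib

noncomputable section

namespace Pinching

open scoped ComplexOrder

/-- A density matrix (quantum state): positive semidefinite with unit trace. -/
structure IsDensity {ι : Type*} [Fintype ι] (M : Matrix ι ι ℂ) : Prop where
  posSemidef : M.PosSemidef
  trace_eq_one : M.trace = 1

/-- A cq-state on `Z B`: a density matrix which is block diagonal in the classical register `Z`,
i.e. of the form `∑ z, p z • |z⟩⟨z| ⊗ ρ_z`. -/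
structure IsCQState {Z B : Type*} [Fintype Z] [Fintype B]
    (ρ : Matrix (Z × B) (Z × B) ℂ) : Prop where
  isDensity : IsDensity ρ
  classical : ∀ z z' : Z, z ≠ z' → ∀ a b : B, ρ (z, a) (z', b) = 0

/-- The reduced state `ρ^B` (partial trace over the classical register). -/
def reducedState {Z B : Type*} [Fintype Z] (ρ : Matrix (Z × B) (Z × B) ℂ) : Matrix B B ℂ :=
  Matrix.of fun a b => ∑ z, ρ (z, a) (z, b)

/-- For a function `f` of the classical register, the unnormalised state of `B` on the event
`f z = w`, namely `∑_{z : f z = w} p z • ρ_z`. Its trace is the probability of the event. -/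
def subState {Z W B : Type*} [Fintype Z] [DecidableEq W] (f : Z → W)
    (ρ : Matrix (Z × B) (Z × B) ℂ) (w : W) : Matrix B B ℂ :=
  Matrix.of fun a b => ∑ z with f z = w, ρ (z, a) (z, b)

/-- `σ w` is the conditional state `ρ_w^B` of the cq-state `ρ` given `f z = w`: a density matrix
with `P(f = w) • σ w = ∑_{z : f z = w} p z • ρ_z`. This determines `σ w` if `P(f = w) > 0`; for
letters of probability zero any density matrix is allowed. -/
structure IsConditionalState {Z W B : Type*} [Fintype Z] [Fintype B] [DecidableEq W] (f : Z → W)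
    (ρ : Matrix (Z × B) (Z × B) ℂ) (σ : W → Matrix B B ℂ) : Prop where
  isDensity : ∀ w, IsDensity (σ w)
  trace_smul : ∀ w, (subState f ρ w).trace • σ w = subState f ρ w

/-- The tensor product `M_1 ⊗ ⋯ ⊗ M_n` of matrices on `B`, as a matrix on `B^n`. -/
def tensor {B : Type*} {n : ℕ} (M : Fin n → Matrix B B ℂ) :
    Matrix (Fin n → B) (Fin n → B) ℂ :=
  Matrix.of fun a b => ∏ i, M i (a i) (b i)

/-- The number of distinct eigenvalues of a square matrix. -/
def numEigenvalues {ι : Type*} [Fintype ι] [DecidableEq ι] (M : Matrix ι ι ℂ) : ℕ :=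
  {μ : ℂ | Module.End.HasEigenvalue (Matrix.toEuclideanLin M) μ}.ncard

/-- The matrix of the orthogonal projection onto the eigenspace of `H` for `μ`. -/
def eigenProj {ι : Type*} [Fintype ι] [DecidableEq ι] (H : Matrix ι ι ℂ) (μ : ℂ) :
    Matrix ι ι ℂ :=
  Matrix.toEuclideanLin.symm
    (Module.End.eigenspace (Matrix.toEuclideanLin H) μ).starProjection.toLinearMap

/-- The pinching map with respect to the spectral decomposition of a Hermitian matrix `H`:
`X ↦ ∑ H_i X H_i`, summed over the distinct eigenvalues of `H`. -/
def pinch {ι : Type*} [Fintype ι] [DecidableEq ι] (H X : Matrix ι ι ℂ) : Matrix ι ι ℂ :=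
  ∑ μ : Module.End.Eigenvalues (Matrix.toEuclideanLin H), eigenProj H μ * X * eigenProj H μ

section

variable {U V X B : Type*} [Fintype U] [Fintype V] [Fintype X] [Fintype B] [DecidableEq B]

/-- `E^{B^n}`, the pinching map of `(ρ^B)^{⊗n}`. -/
def pinch₀ (ρB : Matrix B B ℂ) (n : ℕ) (Y : Matrix (Fin n → B) (Fin n → B) ℂ) :
    Matrix (Fin n → B) (Fin n → B) ℂ :=
  pinch (tensor fun _ : Fin n => ρB) Y

/-- `E_{1|u^n}^{B^n}`, the pinching map of `E^{B^n}(ρ_{u^n})`. -/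
def pinch₁ (ρB : Matrix B B ℂ) (ρU : U → Matrix B B ℂ) {n : ℕ} (u : Fin n → U)
    (Y : Matrix (Fin n → B) (Fin n → B) ℂ) : Matrix (Fin n → B) (Fin n → B) ℂ :=
  pinch (pinch₀ ρB n (tensor fun i => ρU (u i))) Y

/-- The number of distinct eigenvalues of `(ρ^B)^{⊗n}`. -/
def nu (ρB : Matrix B B ℂ) (n : ℕ) : ℕ :=
  numEigenvalues (tensor fun _ : Fin n => ρB)

/-- The maximum over `u^n` of the number of distinct eigenvalues of `E^{B^n}(ρ_{u^n})`. -/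
def nu₁ (ρB : Matrix B B ℂ) (ρU : U → Matrix B B ℂ) (n : ℕ) : ℕ :=
  Finset.univ.sup fun u : Fin n → U =>
    numEigenvalues (pinch₀ ρB n (tensor fun i => ρU (u i)))

/-- The maximum over `u^n, v^n` of the number of distinct eigenvalues of
`E_{1|u^n}^{B^n}(ρ_{v^n})`. -/
def nu₂ (ρB : Matrix B B ℂ) (ρU : U → Matrix B B ℂ) (ρV : V → Matrix B B ℂ) (n : ℕ) : ℕ :=
  Finset.univ.sup fun s : (Fin n → U) × (Fin n → V) =>
    numEigenvalues (pinch₁ ρB ρU s.1 (tensor fun i => ρV (s.2 i)))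

/-- The maximum over `u^n, v^n, x^n` of the number of distinct eigenvalues of
`E_{1|u^n}^{B^n}(ρ_{v^n,x^n})`. -/
def nu₃ (ρB : Matrix B B ℂ) (ρU : U → Matrix B B ℂ) (ρVX : V × X → Matrix B B ℂ) (n : ℕ) : ℕ :=
  Finset.univ.sup fun s : (Fin n → U) × (Fin n → V) × (Fin n → X) =>
    numEigenvalues (pinch₁ ρB ρU s.1 (tensor fun i => ρVX (s.2.1 i, s.2.2 i)))

end

end Pinching

end

/-!
A permutation of the tensor factors that preserves the word `u^n`, `(v^n, u^n)` or
`((x^n, v^n), u^n)` commutes with all the operators involved, and taking a pinching preserves this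
invariance. If `μ` is an eigenvalue of an element `A` of the algebra of invariant matrices, the left
ideal `{F | F A = μ F}` of this algebra is nonzero and stable under the operators that raise a
letter, so it contains a highest-weight matrix. Eigenvectors of right multiplication by `A` with
distinct eigenvalues being independent, the number of eigenvalues is at most the dimension of the
space of highest-weight matrices.

A highest-weight matrix `F` is determined by its entries `F a b` with `b i ≤ a i` for all `i`, and
by invariance such an entry depends only on the joint type of the word and the pairs `(b i, a i)`.
There are `d (d + 1) / 2` such pairs for `d` letters, and a joint type is determined by all but one
of its counts for each letter of the word, which leaves the exponent `d (d + 1) / 2 - 1` per letter.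
For `(ρ^B)^{⊗n}` itself the eigenvalues are products of eigenvalues of `ρ^B`, which depend only on
the type of the word of indices.
-/

noncomputable section

namespace Pinching

open Finset Matrix Module

section JointType

variable {ι T P : Type*} [Fintype ι] [DecidableEq T] [DecidableEq P]

/-- The joint type, in the sense of the method of types, of the words `c` and `f`: the number of
positions at which each pair of letters occurs. -/
def jointType (c : ι → T) (f : ι → P) (q : T × P) : ℕ :=
  #{i | (c i, f i) = q}

theorem jointType_le_card (c : ι → T) (f : ι → P) (q : T × P) :
    jointType c f q ≤ Fintype.card ι :=
  Finset.card_le_univ _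

theorem exists_perm_of_jointType_eq {c : ι → T} {f g : ι → P}
    (h : jointType c f = jointType c g) :
    ∃ σ : Equiv.Perm ι, c ∘ σ = c ∧ f ∘ σ = g := by
  have fiberEquiv (q : T × P) : Nonempty ({i // (c i, g i) = q} ≃ {i // (c i, f i) = q}) :=
    ⟨Fintype.equivOfCardEq <| by
      rw [Fintype.card_subtype, Fintype.card_subtype]
      exact (congrFun h q).symm⟩
  have hσ := fun i => Prod.mk.inj (Equiv.ofFiberEquiv_map (fun q => (fiberEquiv q).some) i)
  exact ⟨_, funext fun i => (hσ i).1, funext fun i => (hσ i).2⟩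

theorem sum_jointType [Fintype P] (c : ι → T) (f : ι → P) (t : T) :
    ∑ p, jointType c f (t, p) = #{i | c i = t} := by
  simp only [jointType, Prod.mk.injEq, ← filter_filter]
  exact (card_eq_sum_card_fiberwise fun _ _ => mem_univ _).symm

theorem jointType_eq_of_forall_ne [Finite P] {c : ι → T} {f g : ι → P} (p₀ : P)
    (h : ∀ t, ∀ p ≠ p₀, jointType c f (t, p) = jointType c g (t, p)) :
    jointType c f = jointType c g := by
  have := Fintype.ofFinite P
  ext ⟨t, p⟩
  rcases eq_or_ne p p₀ with rfl | hp
  · have hsum := (sum_jointType c f t).trans (sum_jointType c g t).symm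
    rw [← add_sum_erase _ _ (mem_univ p), ← add_sum_erase _ _ (mem_univ p),
      sum_congr rfl fun q hq => h t q (ne_of_mem_erase hq)] at hsum
    exact Nat.add_right_cancel hsum
  · exact h t p hp

theorem ncard_range_jointType_le [Fintype T] [Fintype P] (c : ι → T) :
    (Set.range (jointType c : (ι → P) → T × P → ℕ)).ncard ≤
      (Fintype.card ι + 1) ^ (Fintype.card T * (Fintype.card P - 1)) := by
  cases isEmpty_or_nonempty P with
  | inl _ =>
    exact (Set.ncard_le_one_of_subsingleton _).trans (Nat.one_le_pow _ _ (Nat.succ_pos _))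
  | inr hP =>
    obtain ⟨p₀⟩ := hP
    let counts (m : T × P → ℕ) : T × {p // p ≠ p₀} → ℕ := fun q => m (q.1, q.2)
    have hmaps : ∀ m ∈ Set.range (jointType c : (ι → P) → T × P → ℕ),
        counts m ∈ (↑(Fintype.piFinset fun _ : T × {p // p ≠ p₀} => range (Fintype.card ι + 1)) :
          Set (T × {p // p ≠ p₀} → ℕ)) := by
      rintro _ ⟨f, rfl⟩
      simpa [counts, Nat.lt_succ_iff] using fun t p _ => jointType_le_card c f (t, p)
    have hinj : Set.InjOn counts (Set.range (jointType c)) := by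
      rintro _ ⟨f, rfl⟩ _ ⟨g, rfl⟩ hfg
      exact jointType_eq_of_forall_ne p₀ fun t p hp => congrFun hfg (t, ⟨p, hp⟩)
    calc _ ≤ _ := Set.ncard_le_ncard_of_injOn counts hmaps hinj
      _ = _ := by
        rw [Set.ncard_coe_finset, Fintype.card_piFinset, prod_const, card_univ, card_range,
          Fintype.card_prod, Fintype.card_subtype_compl, Fintype.card_subtype_eq]

end JointType

section Eigenvalues

theorem ncard_le_finrank_of_forall_exists_hasEigenvector {K V : Type*} [Field K] [AddCommGroup V]
    [Module K V] (f : End K V) (W : Submodule K V) [FiniteDimensional K W] {s : Set K}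
    (h : ∀ μ ∈ s, ∃ x ∈ W, f.HasEigenvector μ x) : s.ncard ≤ finrank K W := by
  choose x hxW hx using fun μ : s => h μ μ.2
  have hli : LinearIndependent K fun μ => (⟨x μ, hxW μ⟩ : W) :=
    .of_comp W.subtype (End.eigenvectors_linearIndependent f s x hx)
  have := hli.finite
  have := Fintype.ofFinite s
  rw [← Nat.card_coe_set_eq, Nat.card_eq_fintype_card]
  exact hli.fintype_card_le_finrank

theorem exists_mul_eq_smul_of_mem_spectrum {K A : Type*} [Field K] [Ring A] [Algebra K A]
    [FiniteDimensional K A] {a : A} {μ : K} (hμ : μ ∈ spectrum K a) :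
    ∃ x ≠ 0, x * a = μ • x := by
  have : IsArtinianRing A := .of_finite K A
  have hreg : ¬ IsRightRegular (algebraMap K A μ - a) := by
    rwa [← IsArtinianRing.isUnit_iff_isRightRegular]
  rw [isRightRegular_iff_mem_nonZeroDivisorsRight, mem_nonZeroDivisorsRight_iff] at hreg
  push Not at hreg
  obtain ⟨x, hx, hx0⟩ := hreg
  refine ⟨x, hx0, ?_⟩
  rw [mul_sub, sub_eq_zero, ← Algebra.commutes, ← Algebra.smul_def] at hx
  exact hx.symm

theorem numEigenvalues_eq_ncard_spectrum {ι : Type*} [Fintype ι] [DecidableEq ι]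
    (M : Matrix ι ι ℂ) : numEigenvalues M = (spectrum ℂ M).ncard := by
  simp only [numEigenvalues, End.hasEigenvalue_iff_mem_spectrum, spectrum_toLpLin,
    Set.ofPred_mem_eq]

end Eigenvalues

section PinchSubmatrix

variable {ι κ : Type*} [Fintype ι] [DecidableEq ι] [Fintype κ] [DecidableEq κ]

theorem eigenspace_conj {K V W : Type*} [Field K] [AddCommGroup V] [Module K V] [AddCommGroup W]
    [Module K W] (g : V ≃ₗ[K] W) (f : End K V) (μ : K) :
    End.eigenspace (g.conj f) μ = (End.eigenspace f μ).map (g : V →ₗ[K] W) := by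
  ext x
  rw [Submodule.mem_map_equiv, End.mem_eigenspace_iff, End.mem_eigenspace_iff,
    LinearEquiv.conj_apply_apply, ← g.eq_symm_apply, map_smul]

theorem toEuclideanLin_submatrix (M : Matrix ι ι ℂ) (e : κ ≃ ι) :
    toEuclideanLin (M.submatrix e e) =
      (LinearIsometryEquiv.piLpCongrLeft 2 ℂ ℂ e.symm).toLinearEquiv.conj (toEuclideanLin M) := by
  ext x i
  simpa [toLpLin_apply, mulVec, dotProduct, LinearEquiv.conj_apply] using
    (e.sum_comp fun j => M (e i) j * x (e.symm j))

theorem eigenspace_toEuclideanLin_submatrix (H : Matrix ι ι ℂ) (e : κ ≃ ι) (μ : ℂ) :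
    End.eigenspace (toEuclideanLin (H.submatrix e e)) μ =
      (End.eigenspace (toEuclideanLin H) μ).map
        ((LinearIsometryEquiv.piLpCongrLeft 2 ℂ ℂ e.symm).toLinearEquiv :
          EuclideanSpace ℂ ι →ₗ[ℂ] EuclideanSpace ℂ κ) := by
  rw [toEuclideanLin_submatrix, eigenspace_conj]

theorem eigenProj_submatrix (H : Matrix ι ι ℂ) (e : κ ≃ ι) (μ : ℂ) :
    eigenProj (H.submatrix e e) μ = (eigenProj H μ).submatrix e e := by
  apply toEuclideanLin.injective
  rw [toEuclideanLin_submatrix, eigenProj, eigenProj, LinearEquiv.apply_symm_apply,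
    LinearEquiv.apply_symm_apply]
  ext1 x
  simp only [eigenspace_toEuclideanLin_submatrix]
  exact Submodule.starProjection_map_apply _ _ x

theorem pinch_submatrix (H Y : Matrix ι ι ℂ) (e : κ ≃ ι) :
    pinch (H.submatrix e e) (Y.submatrix e e) = (pinch H Y).submatrix e e := by
  have heig (μ : ℂ) : End.HasEigenvalue (toEuclideanLin (H.submatrix e e)) μ ↔
      End.HasEigenvalue (toEuclideanLin H) μ := by
    rw [End.hasEigenvalue_iff, End.hasEigenvalue_iff, eigenspace_toEuclideanLin_submatrix, Ne,
      Submodule.map_eq_bot_iff]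
  let heigEquiv : End.Eigenvalues (toEuclideanLin (H.submatrix e e)) ≃
      End.Eigenvalues (toEuclideanLin H) := Equiv.subtypeEquivRight heig
  calc pinch (H.submatrix e e) (Y.submatrix e e)
      = ∑ μ : End.Eigenvalues (toEuclideanLin (H.submatrix e e)),
          reindexLinearEquiv ℂ ℂ e.symm e.symm (eigenProj H μ * Y * eigenProj H μ) :=
        sum_congr rfl fun μ _ => by simp only [eigenProj_submatrix, submatrix_mul_equiv,
          coe_reindexLinearEquiv, reindex_apply, Equiv.symm_symm]
    _ = reindexLinearEquiv ℂ ℂ e.symm e.symm (pinch H Y) := by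
        rw [pinch, map_sum]
        exact Fintype.sum_equiv heigEquiv _ _ fun _ => rfl

end PinchSubmatrix

section InvariantSubalgebra

variable {R ι T B : Type*} [CommSemiring R] [Fintype ι] [DecidableEq ι] [Fintype B]
  [DecidableEq B]

variable (R B) in
/-- The algebra of matrices on `B^ι` that are invariant under the permutations of the positions
preserving the word `c`, i.e. the commutant of these permutations acting on the tensor power. -/
def invariantSubalgebra (c : ι → T) : Subalgebra R (Matrix (ι → B) (ι → B) R) where
  carrier := {F | ∀ σ : Equiv.Perm ι, c ∘ σ = c → ∀ a b, F (a ∘ σ) (b ∘ σ) = F a b}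
  mul_mem' {F G} hF hG σ hσ a b := by
    simp only [mul_apply]
    rw [← (σ.symm.arrowCongr (Equiv.refl B)).sum_comp]
    exact sum_congr rfl fun x _ => congrArg₂ _ (hF σ hσ a x) (hG σ hσ x b)
  add_mem' hF hG σ hσ a b := congrArg₂ (· + ·) (hF σ hσ a b) (hG σ hσ a b)
  algebraMap_mem' z σ _ a b := by
    simp only [algebraMap_matrix_apply, σ.surjective.injective_comp_right.eq_iff]

theorem tensor_mem_invariantSubalgebra {n : ℕ} (c : Fin n → T) (M : T → Matrix B B ℂ) :
    tensor (fun i => M (c i)) ∈ invariantSubalgebra ℂ B c := by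
  intro σ hσ a b
  have hc (i : Fin n) : c (σ i) = c i := congrFun hσ i
  simpa [tensor, hc] using Equiv.prod_comp σ fun i => M (c i) (a i) (b i)

theorem pinch_mem_invariantSubalgebra {c : ι → T} {H Y : Matrix (ι → B) (ι → B) ℂ}
    (hH : H ∈ invariantSubalgebra ℂ B c) (hY : Y ∈ invariantSubalgebra ℂ B c) :
    pinch H Y ∈ invariantSubalgebra ℂ B c := by
  intro σ hσ a b
  let e := σ.symm.arrowCongr (Equiv.refl B)
  have hsub {F : Matrix (ι → B) (ι → B) ℂ} (hF : F ∈ invariantSubalgebra ℂ B c) :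
      F.submatrix e e = F := Matrix.ext (hF σ hσ)
  have hpinch : (pinch H Y).submatrix e e = pinch H Y := by
    rw [← pinch_submatrix, hsub hH, hsub hY]
  exact congrFun₂ hpinch a b

theorem pinch₀_mem_invariantSubalgebra {n : ℕ} (c : Fin n → T) (ρB : Matrix B B ℂ)
    (σ : T → Matrix B B ℂ) :
    pinch₀ ρB n (tensor fun i => σ (c i)) ∈ invariantSubalgebra ℂ B c :=
  pinch_mem_invariantSubalgebra (tensor_mem_invariantSubalgebra c fun _ => ρB)
    (tensor_mem_invariantSubalgebra c σ)

theorem pinch₁_mem_invariantSubalgebra {U : Type*} {n : ℕ} (c : Fin n → T) (u : T → U)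
    (ρB : Matrix B B ℂ) (ρU : U → Matrix B B ℂ) (σ : T → Matrix B B ℂ) :
    pinch₁ ρB ρU (fun i => u (c i)) (tensor fun i => σ (c i)) ∈ invariantSubalgebra ℂ B c :=
  pinch_mem_invariantSubalgebra (pinch₀_mem_invariantSubalgebra c ρB (ρU ∘ u))
    (tensor_mem_invariantSubalgebra c σ)

end InvariantSubalgebra

section HighestWeight

variable {R 𝕜 ι T B : Type*} [CommSemiring R] [Field 𝕜] [Fintype ι] [DecidableEq ι] [Fintype B]
  [DecidableEq B] [DecidableEq T]

variable (R) in
/-- The matrix of `∑ |l⟩⟨k|`, summed over the positions that carry the letter `t` of the word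
`c`. When the letters are ordered by `r : B → ℕ` and `r k < r l`, it raises the weight
`∑ i, r (a i)` of a basis vector `a` and is the action of a positive root vector of the Lie algebra
`𝔤𝔩(B)^T`. -/
def raisingMatrix (c : ι → T) (t : T) (k l : B) : Matrix (ι → B) (ι → B) R :=
  of fun a x => ∑ i with c i = t ∧ a i = l, if x = Function.update a i k then 1 else 0

theorem raisingMatrix_mul_apply (c : ι → T) (t : T) (k l : B)
    (F : Matrix (ι → B) (ι → B) R) (a b : ι → B) :
    (raisingMatrix R c t k l * F) a b =
      ∑ i with c i = t ∧ a i = l, F (Function.update a i k) b := by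
  simp only [raisingMatrix, mul_apply, of_apply, sum_mul, ite_mul, one_mul, zero_mul]
  rw [sum_comm]
  simp only [sum_ite_eq', mem_univ, if_true]

theorem raisingMatrix_mem_invariantSubalgebra (c : ι → T) (t : T) (k l : B) :
    raisingMatrix R c t k l ∈ invariantSubalgebra R B c := by
  intro σ hσ a x
  have hc (i : ι) : c (σ i) = c i := congrFun hσ i
  have hupdate (i : ι) :
      x ∘ σ = Function.update (a ∘ σ) i k ↔ x = Function.update a (σ i) k := by
    rw [← σ.surjective.injective_comp_right.eq_iff (a := x),
      Function.update_comp_equiv, Equiv.symm_apply_apply]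
  simp only [raisingMatrix, of_apply, sum_filter, Function.comp_apply, hupdate]
  simpa only [hc] using Equiv.sum_comp σ fun i =>
    if c i = t ∧ a i = l then if x = Function.update a i k then (1 : R) else 0 else 0

variable (R) in
/-- The highest-weight matrices: the elements of the invariant algebra annihilated from the left
by all raising matrices, where the letters are ordered by their values under `r`. -/
def highestWeightSubmodule (c : ι → T) (r : B → ℕ) :
    Submodule R (Matrix (ι → B) (ι → B) R) where
  carrier := {F | F ∈ invariantSubalgebra R B c ∧
    ∀ t k l, r k < r l → raisingMatrix R c t k l * F = 0}
  zero_mem' := ⟨zero_mem _, fun _ _ _ _ => mul_zero _⟩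
  add_mem' hF hG := ⟨add_mem hF.1 hG.1, fun t k l hkl => by
    rw [mul_add, hF.2 t k l hkl, hG.2 t k l hkl, add_zero]⟩
  smul_mem' z F hF := ⟨Subalgebra.smul_mem _ hF.1 z, fun t k l hkl => by
    rw [Matrix.mul_smul, hF.2 t k l hkl, smul_zero]⟩

/-- Raising matrices increase the least weight `∑ i, r (a i)` in the support of a matrix, so any
nonzero element of `W` for which this least weight is largest will do. -/
theorem exists_ne_zero_forall_raisingMatrix_mul_eq_zero (c : ι → T) (r : B → ℕ)
    {W : Set (Matrix (ι → B) (ι → B) R)} (hW : ∃ F ∈ W, F ≠ 0)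
    (hraise : ∀ F ∈ W, ∀ t k l, r k < r l → raisingMatrix R c t k l * F ∈ W) :
    ∃ F ∈ W, F ≠ 0 ∧ ∀ t k l, r k < r l → raisingMatrix R c t k l * F = 0 := by
  let P (s : ℕ) : Prop := ∃ F ∈ W, F ≠ 0 ∧ ∀ a b, ∑ i, r (a i) < s → F a b = 0
  obtain ⟨F₀, hF₀W, hF₀⟩ := hW
  have hP_zero : P 0 := ⟨F₀, hF₀W, hF₀, fun a b h => absurd h (Nat.not_lt_zero _)⟩
  have hP_large : ∃ s, ¬ P s := by
    refine ⟨univ.sup (fun a : ι → B => ∑ i, r (a i)) + 1, fun ⟨F, _, hF, hsupp⟩ => hF ?_⟩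
    ext a b
    exact hsupp a b (Nat.lt_succ_of_le (le_sup (f := fun a : ι → B => ∑ i, r (a i)) (mem_univ a)))
  obtain ⟨s, ⟨F, hFW, hF, hsupp⟩, hs⟩ : ∃ s, P s ∧ ¬ P (s + 1) := by
    by_contra! h
    obtain ⟨s, hs⟩ := hP_large
    exact hs (Nat.rec hP_zero (fun s => h s) s)
  refine ⟨F, hFW, hF, fun t k l hkl => by_contra fun hne => hs
    ⟨raisingMatrix R c t k l * F, hraise F hFW t k l hkl, hne, fun a b ha => ?_⟩⟩
  rw [raisingMatrix_mul_apply]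
  refine sum_eq_zero fun i hi => hsupp _ b (lt_of_lt_of_le ?_ (Nat.le_of_lt_succ ha))
  have hlower : r ∘ Function.update a i k < r ∘ a := by
    rw [Function.comp_update]
    exact update_lt_self_iff.2 (hkl.trans_eq (congrArg r (mem_filter.1 hi).2.2.symm))
  exact Fintype.sum_strictMono hlower

theorem sum_mul_lt_sum_comp_swap_mul {S : Type*} [Semiring S] [PartialOrder S]
    [IsStrictOrderedRing S] [ExistsAddOfLE S] {x y : ι → S} {i j : ι} (hx : x i < x j)
    (hy : y j < y i) :
    ∑ p, x p * y p < ∑ p, x (Equiv.swap i j p) * y p := by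
  have hij : i ≠ j := fun h => hx.ne (congrArg x h)
  rw [← sum_add_sum_compl {i, j}, ← sum_add_sum_compl {i, j}, sum_pair hij, sum_pair hij,
    Equiv.swap_apply_left, Equiv.swap_apply_right]
  refine add_lt_add_of_lt_of_le ?_ (sum_le_sum fun p hp => ?_)
  · exact (mul_add_mul_lt_mul_add_mul hx hy).trans_eq (add_comm _ _)
  · simp only [mem_compl, mem_insert, mem_singleton, not_or] at hp
    rw [Equiv.swap_apply_of_ne_of_ne hp.1 hp.2]

theorem raisingMatrix_mul_apply_update (c : ι → T) (F : Matrix (ι → B) (ι → B) R) (a b : ι → B)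
    {i : ι} {k : B} (hk : k ≠ a i) :
    (raisingMatrix R c (c i) (a i) k * F) (Function.update a i k) b =
      F a b + ∑ j with c j = c i ∧ a j = k, F (a ∘ Equiv.swap i j) b := by
  have hfilter : filter (fun j => c j = c i ∧ Function.update a i k j = k) univ =
      insert i (filter (fun j => c j = c i ∧ a j = k) univ) := by
    ext j
    by_cases hj : j = i <;> simp [hj]
  rw [raisingMatrix_mul_apply, hfilter, sum_insert (by simp [hk.symm]),
    Function.update_idem, Function.update_eq_self]
  refine congrArg _ (sum_congr rfl fun j hj => ?_)
  have hj : a j = k := (mem_filter.1 hj).2.2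
  have hji : j ≠ i := fun h => hk (hj.symm.trans (congrArg a h))
  rw [Equiv.comp_swap_eq_update, hj, Function.update_comm hji]

theorem apply_eq_zero_of_mem_highestWeightSubmodule [IsAddTorsionFree R] {c : ι → T} {r : B → ℕ}
    {F : Matrix (ι → B) (ι → B) R} (hF : F ∈ highestWeightSubmodule R c r) {a b : ι → B} {i : ι}
    (hi : r (a i) < r (b i))
    (hswap : ∀ j, c j = c i → a j = b i → b j ≠ b i → F (a ∘ Equiv.swap i j) b = 0) :
    F a b = 0 := by
  have hterm : ∀ j ∈ filter (fun j => c j = c i ∧ a j = b i) univ,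
      F (a ∘ Equiv.swap i j) b = if b j = b i then F a b else 0 := by
    intro j hj
    obtain ⟨hcj, haj⟩ := (mem_filter.1 hj).2
    split_ifs with hbj
    · have hc : c ∘ Equiv.swap i j = c := funext (Equiv.apply_swap_eq_self hcj.symm)
      have hb : b ∘ Equiv.swap i j = b := funext (Equiv.apply_swap_eq_self hbj.symm)
      simpa only [hb] using hF.1 _ hc a b
    · exact hswap j hcj haj hbj
  have hrel := congrFun₂ (hF.2 (c i) (a i) (b i) hi) (Function.update a i (b i)) b
  rw [raisingMatrix_mul_apply_update c F a b fun h => hi.ne (congrArg r h.symm),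
    sum_congr rfl hterm, ← sum_filter, sum_const, Matrix.zero_apply, ← succ_nsmul',
    smul_eq_zero] at hrel
  exact hrel.resolve_left (Nat.succ_ne_zero _)

/-- Among the nonzero entries `F a b` that violate the conclusion, take one maximizing
`∑ i, r (a i) * r (b i)`; at the violating position with `r (b i)` largest, annihilation by the
raising matrix expresses a positive multiple of `F a b` through entries with a larger sum. -/
theorem eq_zero_of_mem_highestWeightSubmodule [IsAddTorsionFree R] {c : ι → T} {r : B → ℕ}
    (hr : Function.Injective r) {F : Matrix (ι → B) (ι → B) R}
    (hF : F ∈ highestWeightSubmodule R c r) (h : ∀ a b, (∀ i, r (b i) ≤ r (a i)) → F a b = 0) :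
    F = 0 := by
  by_contra hF0
  obtain ⟨a₀, b₀, h₀⟩ : ∃ a b, F a b ≠ 0 := by
    by_contra! hzero
    exact hF0 (Matrix.ext hzero)
  obtain ⟨⟨a, b⟩, hab, hmax⟩ := Set.exists_max_image {p : (ι → B) × (ι → B) | F p.1 p.2 ≠ 0}
    (fun p => ∑ i, r (p.1 i) * r (p.2 i)) (Set.toFinite _) ⟨(a₀, b₀), h₀⟩
  obtain ⟨i₀, hi₀⟩ : ∃ i, r (a i) < r (b i) := by
    by_contra! hle
    exact hab (h a b hle)
  obtain ⟨i, hi, himax⟩ := Set.exists_max_image {i | r (a i) < r (b i)} (fun i => r (b i))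
    (Set.toFinite _) ⟨i₀, hi₀⟩
  refine hab (apply_eq_zero_of_mem_highestWeightSubmodule hF hi fun j _ haj hbj => ?_)
  have hbj_lt : r (b j) < r (b i) := by
    refine lt_of_le_of_ne (not_lt.1 fun hlt => ?_) (hr.ne hbj)
    exact hlt.not_ge (himax j ((congrArg r haj).trans_lt hlt))
  by_contra hne
  exact (sum_mul_lt_sum_comp_swap_mul (x := r ∘ a) (y := r ∘ b) (hi.trans_eq (congrArg r haj.symm))
    hbj_lt).not_ge (hmax (_, b) hne)

theorem exists_hasEigenvector_mem_highestWeightSubmodule {c : ι → T} (r : B → ℕ)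
    {A : Matrix (ι → B) (ι → B) 𝕜} (hA : A ∈ invariantSubalgebra 𝕜 B c) {μ : 𝕜}
    (hμ : μ ∈ spectrum 𝕜 A) :
    ∃ F ∈ highestWeightSubmodule 𝕜 c r, End.HasEigenvector (LinearMap.mulRight 𝕜 A) μ F := by
  let W := {F | F ∈ invariantSubalgebra 𝕜 B c ∧ F * A = μ • F}
  have hW : ∃ F ∈ W, F ≠ 0 := by
    obtain ⟨F, hF, hFA⟩ := exists_mul_eq_smul_of_mem_spectrum
      (spectrum.subset_subalgebra (⟨A, hA⟩ : invariantSubalgebra 𝕜 B c) hμ)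
    exact ⟨F, ⟨F.2, congrArg Subtype.val hFA⟩, Subtype.coe_ne_coe.2 hF⟩
  have hraise : ∀ F ∈ W, ∀ t k l, r k < r l → raisingMatrix 𝕜 c t k l * F ∈ W := by
    rintro F ⟨hF, hFA⟩ t k l -
    exact ⟨mul_mem (raisingMatrix_mem_invariantSubalgebra c t k l) hF,
      by rw [mul_assoc, hFA, Matrix.mul_smul]⟩
  obtain ⟨F, ⟨hF, hFA⟩, hF0, hkill⟩ :=
    exists_ne_zero_forall_raisingMatrix_mul_eq_zero c r hW hraise
  exact ⟨F, ⟨hF, hkill⟩, End.mem_eigenspace_iff.2 hFA, hF0⟩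

theorem finrank_highestWeightSubmodule_le [CharZero 𝕜] [Fintype T] (c : ι → T) {r : B → ℕ}
    (hr : Function.Injective r) :
    finrank 𝕜 (highestWeightSubmodule 𝕜 c r) ≤ (Fintype.card ι + 1) ^
      (Fintype.card T * (Fintype.card {p : B × B // r p.1 ≤ r p.2} - 1)) := by
  let types := Set.range (jointType c : (ι → {p : B × B // r p.1 ≤ r p.2}) → _)
  have := Fintype.ofFinite types
  choose word hword using fun m : types => m.2
  let entries : highestWeightSubmodule 𝕜 c r →ₗ[𝕜] types → 𝕜 := LinearMap.pi fun m =>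
    entryLinearMap 𝕜 𝕜 (fun i => (word m i).1.2) (fun i => (word m i).1.1) ∘ₗ
      Submodule.subtype _
  have hentries : Function.Injective entries := by
    refine (injective_iff_map_eq_zero entries).2 fun F hF => Subtype.ext ?_
    refine eq_zero_of_mem_highestWeightSubmodule hr F.2 fun a b hab => ?_
    let f : ι → {p : B × B // r p.1 ≤ r p.2} := fun i => ⟨(b i, a i), hab i⟩
    let m : types := ⟨jointType c f, f, rfl⟩
    obtain ⟨σ, hc, hσ⟩ := exists_perm_of_jointType_eq (hword m)
    have hpair (i : ι) : (word m (σ i)).1 = (b i, a i) := congrArg Subtype.val (congrFun hσ i)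
    calc F.1 a b
        = F.1 ((fun i => (word m i).1.2) ∘ σ) ((fun i => (word m i).1.1) ∘ σ) := by
          simp only [Function.comp_def, hpair]
      _ = F.1 (fun i => (word m i).1.2) (fun i => (word m i).1.1) := F.2.1 σ hc _ _
      _ = 0 := congrFun hF m
  calc finrank 𝕜 (highestWeightSubmodule 𝕜 c r)
      ≤ finrank 𝕜 (types → 𝕜) := LinearMap.finrank_le_finrank_of_injective hentries
    _ = types.ncard := by
      rw [finrank_fintype_fun_eq_card, ← Nat.card_eq_fintype_card, Nat.card_coe_set_eq]
    _ ≤ _ := ncard_range_jointType_le c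

end HighestWeight

theorem card_subtype_le_sub_one {B : Type*} [Fintype B] {r : B → ℕ} (hr : Function.Injective r) :
    Fintype.card {p : B × B // r p.1 ≤ r p.2} - 1 =
      (Fintype.card B + 2) * (Fintype.card B - 1) / 2 := by
  let _ : LinearOrder B := LinearOrder.lift' r hr
  have hcard : Fintype.card {p : B × B // r p.1 ≤ r p.2} = (Fintype.card B + 1).choose 2 := by
    rw [← Sym2.card]
    exact Fintype.card_congr Sym2.sortEquiv.symm
  rw [hcard, Nat.choose_two_right]
  cases Fintype.card B with
  | zero => rfl
  | succ d =>
    have hd : (d + 1 + 1) * (d + 1) = (d + 1 + 2) * d + 2 := by ring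
    simp only [hd, Nat.add_div_right _ zero_lt_two, Nat.succ_sub_one]

theorem numEigenvalues_le_of_mem_invariantSubalgebra {ι T B : Type*} [Fintype ι] [DecidableEq ι]
    [Fintype T] [Fintype B] [DecidableEq B] {c : ι → T} {A : Matrix (ι → B) (ι → B) ℂ}
    (hA : A ∈ invariantSubalgebra ℂ B c) :
    numEigenvalues A ≤ (Fintype.card ι + 1) ^
      (Fintype.card T * (Fintype.card B + 2) * (Fintype.card B - 1) / 2) := by
  classical
  let r : B → ℕ := fun b => Fintype.equivFin B b
  have hr : Function.Injective r := Fin.val_injective.comp (Fintype.equivFin B).injective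
  calc numEigenvalues A
      = (spectrum ℂ A).ncard := numEigenvalues_eq_ncard_spectrum A
    _ ≤ finrank ℂ (highestWeightSubmodule ℂ c r) :=
      ncard_le_finrank_of_forall_exists_hasEigenvector (LinearMap.mulRight ℂ A) _
        fun _ hμ => exists_hasEigenvector_mem_highestWeightSubmodule r hA hμ
    _ ≤ _ := finrank_highestWeightSubmodule_le c hr
    _ ≤ _ := by
      rw [card_subtype_le_sub_one hr, mul_assoc]
      exact Nat.pow_le_pow_right (Nat.succ_pos _) (Nat.mul_div_le_mul_div_assoc _ _ _)

section Tensor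

variable {B : Type*} {n : ℕ}

theorem tensor_mul [Fintype B] (M N : Fin n → Matrix B B ℂ) :
    tensor (M * N) = tensor M * tensor N := by
  classical
  ext a b
  simp only [tensor, Pi.mul_apply, of_apply, mul_apply, Fintype.prod_sum, ← prod_mul_distrib]

theorem tensor_diagonal [DecidableEq B] (D : Fin n → B → ℂ) :
    tensor (fun i => diagonal (D i)) = diagonal fun a : Fin n → B => ∏ i, D i (a i) := by
  ext a b
  rcases eq_or_ne a b with rfl | hab
  · simp only [tensor, of_apply, diagonal_apply_eq]
  · obtain ⟨i, hi⟩ := Function.ne_iff.1 hab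
    rw [diagonal_apply_ne _ hab]
    exact prod_eq_zero (mem_univ i) (diagonal_apply_ne _ hi)

theorem tensor_one [DecidableEq B] : tensor (1 : Fin n → Matrix B B ℂ) = 1 := by
  simpa using! tensor_diagonal (n := n) fun _ (_ : B) => (1 : ℂ)

variable [Fintype B] [DecidableEq B]

/-- The tensor product as a monoid homomorphism; it carries a similarity of the factors to a
similarity of the products. -/
def tensorHom (B : Type*) [Fintype B] [DecidableEq B] (n : ℕ) :
    (Fin n → Matrix B B ℂ) →* Matrix (Fin n → B) (Fin n → B) ℂ where
  toFun := tensor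
  map_one' := tensor_one
  map_mul' := tensor_mul

theorem spectrum_tensor_of_isHermitian {M : Fin n → Matrix B B ℂ} (hM : ∀ i, (M i).IsHermitian) :
    spectrum ℂ (tensor M) =
      Set.range fun a : Fin n → B => ∏ i, ((hM i).eigenvalues (a i) : ℂ) := by
  let W : (Fin n → Matrix B B ℂ)ˣ :=
    MulEquiv.piUnits.symm fun i => Unitary.toUnits (hM i).eigenvectorUnitary
  let D : Fin n → B → ℂ := fun i b => (hM i).eigenvalues b
  let U : (Matrix (Fin n → B) (Fin n → B) ℂ)ˣ := Units.map (tensorHom B n) W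
  have hspectral : tensor M = U.1 * diagonal (fun a => ∏ i, D i (a i)) * U⁻¹.1 := by
    have hM' : M = W * (fun i => diagonal (D i)) * ↑W⁻¹ := funext fun i => (hM i).spectral_theorem
    rw [← tensor_diagonal]
    exact (congrArg (tensorHom B n) hM').trans (by simp only [map_mul]; rfl)
  rw [hspectral, spectrum.units_conjugate, spectrum_diagonal]

theorem numEigenvalues_tensor_le {M : Matrix B B ℂ} (hM : M.IsHermitian) (n : ℕ) :
    numEigenvalues (tensor fun _ : Fin n => M) ≤ (n + 1) ^ (Fintype.card B - 1) := by
  let type : (Fin n → B) → Unit × B → ℕ := jointType fun _ => ()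
  let eigenvalue (a : Fin n → B) : ℂ := ∏ i, (hM.eigenvalues (a i) : ℂ)
  have htype : eigenvalue.FactorsThrough type := by
    intro a b hab
    obtain ⟨σ, -, rfl⟩ := exists_perm_of_jointType_eq hab
    exact (Equiv.prod_comp σ fun i => (hM.eigenvalues (a i) : ℂ)).symm
  obtain ⟨g, hg⟩ := (Function.factorsThrough_iff eigenvalue).1 htype
  calc numEigenvalues (tensor fun _ : Fin n => M)
      = (Set.range eigenvalue).ncard := by
        rw [numEigenvalues_eq_ncard_spectrum, spectrum_tensor_of_isHermitian fun _ => hM]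
    _ = (g '' Set.range type).ncard := by rw [hg, Set.range_comp]
    _ ≤ (Set.range type).ncard := Set.ncard_image_le (Set.finite_range _)
    _ ≤ (n + 1) ^ (Fintype.card B - 1) := by
        simpa using ncard_range_jointType_le (P := B) fun _ : Fin n => ()

end Tensor

open scoped ComplexOrder in
theorem IsCQState.isHermitian_reducedState {Z B : Type*} [Fintype Z] [Fintype B]
    {ρ : Matrix (Z × B) (Z × B) ℂ} (hρ : IsCQState ρ) : (reducedState ρ).IsHermitian := by
  refine IsHermitian.ext fun a b => ?_
  simp only [reducedState, of_apply, star_sum]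
  exact sum_congr rfl fun z _ => hρ.isDensity.posSemidef.isHermitian.apply _ _

end Pinching

end

open Pinching in
theorem proposition1_general {U V X B : Type*} [Fintype U] [Fintype V] [Fintype X] [Fintype B]
    [DecidableEq B] {ρB : Matrix B B ℂ} (hρB : ρB.IsHermitian) (ρU : U → Matrix B B ℂ)
    (ρV : V → Matrix B B ℂ) (ρVX : V × X → Matrix B B ℂ) (n : ℕ) :
    nu ρB n ≤ (n + 1) ^ (Fintype.card B - 1) ∧
    nu₁ ρB ρU n ≤ (n + 1) ^ (Fintype.card U * (Fintype.card B + 2) * (Fintype.card B - 1) / 2) ∧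
    nu₂ ρB ρU ρV n ≤ (n + 1) ^ (Fintype.card V * Fintype.card U *
      (Fintype.card B + 2) * (Fintype.card B - 1) / 2) ∧
    nu₃ ρB ρU ρVX n ≤ (n + 1) ^ (Fintype.card X * Fintype.card V * Fintype.card U *
      (Fintype.card B + 2) * (Fintype.card B - 1) / 2) := by
  refine ⟨numEigenvalues_tensor_le hρB n, Finset.sup_le fun u _ => ?_, Finset.sup_le fun s _ => ?_,
    Finset.sup_le fun s _ => ?_⟩
  · simpa only [Fintype.card_fin] using
      numEigenvalues_le_of_mem_invariantSubalgebra (pinch₀_mem_invariantSubalgebra u ρB ρU)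
  · simpa only [Fintype.card_fin, Fintype.card_prod] using
      numEigenvalues_le_of_mem_invariantSubalgebra (pinch₁_mem_invariantSubalgebra
        (fun i => (s.2 i, s.1 i)) Prod.snd ρB ρU fun t => ρV t.1)
  · simpa only [Fintype.card_fin, Fintype.card_prod] using
      numEigenvalues_le_of_mem_invariantSubalgebra (pinch₁_mem_invariantSubalgebra
        (fun i => ((s.2.2 i, s.2.1 i), s.1 i)) Prod.snd ρB ρU fun t => ρVX (t.1.2, t.1.1))

theorem proposition1 {U V X B : Type*} [Fintype U] [Fintype V] [Fintype X] [Fintype B]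
    [DecidableEq U] [DecidableEq V] [DecidableEq X] [DecidableEq B]
    (ρ : Matrix ((U × V × X) × B) ((U × V × X) × B) ℂ) (hρ : Pinching.IsCQState ρ)
    (ρU : U → Matrix B B ℂ) (hU : Pinching.IsConditionalState (fun z : U × V × X => z.1) ρ ρU)
    (ρV : V → Matrix B B ℂ) (hV : Pinching.IsConditionalState (fun z : U × V × X => z.2.1) ρ ρV)
    (ρVX : V × X → Matrix B B ℂ)
    (hVX : Pinching.IsConditionalState (fun z : U × V × X => z.2) ρ ρVX)
    (n : ℕ) :
    Pinching.nu (Pinching.reducedState ρ) n ≤ (n + 1) ^ (Fintype.card B - 1) ∧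
    Pinching.nu₁ (Pinching.reducedState ρ) ρU n ≤
      (n + 1) ^ (Fintype.card U * (Fintype.card B + 2) * (Fintype.card B - 1) / 2) ∧
    Pinching.nu₂ (Pinching.reducedState ρ) ρU ρV n ≤
      (n + 1) ^ (Fintype.card V * Fintype.card U *
        (Fintype.card B + 2) * (Fintype.card B - 1) / 2) ∧
    Pinching.nu₃ (Pinching.reducedState ρ) ρU ρVX n ≤
      (n + 1) ^ (Fintype.card X * Fintype.card V * Fintype.card U *
        (Fintype.card B + 2) * (Fintype.card B - 1) / 2) := by
  exact proposition1_general hρ.isHermitian_reducedState ρU ρV ρVX n
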